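/- Let $d\ge 1$ and let $G=(V,E)$ be a finite simple graph. A realization (framework) of $G$ in $\mathbb{R}^d$ is a pair $(G,p)$ with $p:V\to\mathbb{R}^d$; it is generic if its $d|V|$ vertex coordinates are algebraically independent over $\mathbb{Q}$. Two realizations $(G,p)$ and $(G,q)$ are equivalent if $\|p(x)-p(y)\|=\|q(x)-q(y)\|$ for all $xy\in E$, and congruent if this holds for all $x,y\in V$. The framework $(G,p)$ is rigid if there is $\varepsilon>0$ such that every $(G,q)$ that is equivalent to $(G,p)$ and satisfies $\|p(x)-q(x)\|<\varepsilon$ for all $x\in V$ is congruent to $(G,p)$; a graph is rigid in $\mathbb{R}^d$ if each of its generic realizations in $\mathbb{R}^d$ is rigid. For $u,v\in V$, the pair $\{u,v\}$ is weakly globally linked in $G$ in $\mathbb{R}^d$ if there is a generic realization $(G,p)$ in $\mathbb{R}^d$ such that $\|p(u)-p(v)\|=\|q(u)-q(v)\|$ for every realization $(G,q)$ in $\mathbb{R}^d$ equivalent to $(G,p)$. For $X\subseteq V$, the induced subgraph $G[X]$ is $(u,v)$-rigid if $u,v\in X$ and $G[X]$ is rigid in $\mathbb{R}^d$, and $G/X$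 denotes the simple graph obtained from $G$ by identifying the vertices of $X$ and removing the resulting loops and parallel copies of edges. Let $u,v\in V$ and let $V_0\subseteq V$ be such that $G[V_0]$ is $(u,v)$-rigid in $\mathbb{R}^d$, and let $V_1$ be the vertex set of a connected component of $G-V_0$. Then $\{u,v\}$ is weakly globally linked in $G$ in $\mathbb{R}^d$ if and only if $\{u,v\}$ is weakly globally linked in $G/V_1$ in $\mathbb{R}^d$. -/

import Mathlib

/-! A realization of a graph on `V` in `ℝ^d` is a map `p : V → EuclideanSpace ℝ (Fin d)`. -/

namespace Rigidity

/-- The frameworks `(G, p)` and `(G, q)` are equivalent: corresponding edge lengths agree. -/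
def Equivalent {V : Type*} {d : ℕ} (G : SimpleGraph V) (p q : V → EuclideanSpace ℝ (Fin d)) :
    Prop :=
  ∀ x y : V, G.Adj x y → ‖p x - p y‖ = ‖q x - q y‖

/-- `p` and `q` are congruent: all pairwise distances agree. -/
def Congruent {V : Type*} {d : ℕ} (p q : V → EuclideanSpace ℝ (Fin d)) : Prop :=
  ∀ x y : V, ‖p x - p y‖ = ‖q x - q y‖

/-- `p` is generic: its `d |V|` vertex coordinates are algebraically independent over `ℚ`. -/
def Generic {V : Type*} {d : ℕ} (p : V → EuclideanSpace ℝ (Fin d)) : Prop :=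
  AlgebraicIndependent ℚ (fun i : V × Fin d => p i.1 i.2)

/-- The framework `(G, p)` is rigid: every equivalent framework that is close enough to it is
congruent to it. -/
def RigidFramework {V : Type*} {d : ℕ} (G : SimpleGraph V) (p : V → EuclideanSpace ℝ (Fin d)) :
    Prop :=
  ∃ ε : ℝ, 0 < ε ∧ ∀ q : V → EuclideanSpace ℝ (Fin d),
    Equivalent G p q → (∀ x, ‖p x - q x‖ < ε) → Congruent p q

/-- The graph `G` is rigid in `ℝ^d`: every generic realization of `G` in `ℝ^d` is rigid. -/
def RigidGraph {V : Type*} (d : ℕ) (G : SimpleGraph V) : Prop :=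
  ∀ p : V → EuclideanSpace ℝ (Fin d), Generic p → RigidFramework G p

/-- The induced subgraph `G[X]` is `(u, v)`-rigid in `ℝ^d`. -/
def PairRigid {V : Type*} (d : ℕ) (G : SimpleGraph V) (u v : V) (X : Set V) : Prop :=
  RigidGraph d (G.induce X) ∧ u ∈ X ∧ v ∈ X

/-- `{u, v}` is globally linked in the framework `(G, p)`. -/
def GloballyLinked {V : Type*} {d : ℕ} (G : SimpleGraph V) (p : V → EuclideanSpace ℝ (Fin d))
    (u v : V) : Prop :=
  ∀ q : V → EuclideanSpace ℝ (Fin d), Equivalent G p q → ‖p u - p v‖ = ‖q u - q v‖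

/-- `{u, v}` is weakly globally linked in the graph `G` in `ℝ^d`: it is globally linked in some
generic realization of `G`. -/
def WeaklyGloballyLinked {V : Type*} (d : ℕ) (G : SimpleGraph V) (u v : V) : Prop :=
  ∃ p : V → EuclideanSpace ℝ (Fin d), Generic p ∧ GloballyLinked G p u v

/-- The equivalence relation on `V` that identifies all elements of `S` with each other. -/
def contractSetoid {V : Type*} (S : Set V) : Setoid V where
  r x y := x = y ∨ (x ∈ S ∧ y ∈ S)
  iseqv :=
    { refl := fun _ => Or.inl rfl
      symm := fun h => h.elim (fun e => Or.inl e.symm) (fun e => Or.inr ⟨e.2, e.1⟩)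
      trans := by
        rintro x y z (rfl | ⟨hx, hy⟩) (rfl | ⟨hy', hz⟩)
        · exact Or.inl rfl
        · exact Or.inr ⟨hy', hz⟩
        · exact Or.inr ⟨hx, hy⟩
        · exact Or.inr ⟨hx, hz⟩ }

/-- The vertex set of `G / S`. -/
abbrev ContractVertex {V : Type*} (S : Set V) : Type _ := Quotient (contractSetoid S)

/-- The vertex of `G / S` that arises from the vertex `x` of `G`. -/
def toContract {V : Type*} (S : Set V) (x : V) : ContractVertex S :=
  Quotient.mk (contractSetoid S) x

/-- The contraction `G / S`: the vertices of `S` are identified, and loops and parallel edges are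
removed. -/
def contract {V : Type*} (G : SimpleGraph V) (S : Set V) : SimpleGraph (ContractVertex S) :=
  G.map (toContract S)

/-- `S` is the vertex set of a connected component of `G - X`. -/
def IsComponentOfDelete {V : Type*} (G : SimpleGraph V) (X S : Set V) : Prop :=
  ∃ C : (G.induce Xᶜ).ConnectedComponent, S = Subtype.val '' C.supp

end Rigidity

/-! Rigidity of `G[V₀]` enters only through `RigidGraph.finite_distances`: realizations equivalent
to a generic one give each pair finitely many distances. Indeed a squared distance that is locally
constant on the level set of the squared edge lengths is algebraic over them, hence a root of one
fixed nonzero polynomial.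

From `G` to `G/V₁`: keep `p` off `V₁` and put the contracted vertex at a point `c`. Finiteness gives
an open set of `c` for which the distances from `c` to the neighbours `N` of `V₁` force `N` to be
congruent to its original position (`exists_isOpen_congruent`). A realization equivalent to this one
then lifts to `G`: place `V₁` by the isometry that carries `N` along. Openness leaves room to make
`c` generic.

From `G/V₁` to `G`: approximate the realization collapsing `V₁` by generic ones that differ from it
only on `V₁`. Were `{u, v}` linked in none of them, the counterexamples would have a limit that
descends to `G/V₁`, so their `u`-`v` distances would converge to the original one. These distances
lie in a fixed finite set, so they eventually equal it, a contradiction. -/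

namespace Rigidity

/-! ### Algebraic dependence and level sets of polynomials at a generic point. -/

open MvPolynomial Topology Filter

/-- If `D` is algebraic over the subalgebra generated by `s`, then `D` takes finitely many values
on the points at which the elements of `s` have the same values as at a generic point. -/
theorem finite_values_of_isAlgebraic {ι : Type*} {x : ι → ℝ} (hx : AlgebraicIndependent ℚ x)
    {s : Set (MvPolynomial ι ℚ)} {D : MvPolynomial ι ℚ}
    (hD : IsAlgebraic (Algebra.adjoin ℚ s) D) :
    {r : ℝ | ∃ y : ι → ℝ, (∀ f ∈ s, aeval y f = aeval x f) ∧ aeval y D = r}.Finite := by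
  obtain ⟨P, hP0, hP⟩ := hD
  let ev (y : ι → ℝ) : Algebra.adjoin ℚ s →+* ℝ :=
    ((aeval y : MvPolynomial ι ℚ →ₐ[ℚ] ℝ) : MvPolynomial ι ℚ →+* ℝ).comp
      (algebraMap (Algebra.adjoin ℚ s) (MvPolynomial ι ℚ))
  -- Genericity keeps `P` nonzero after its coefficients are evaluated at `x`.
  have hinj : Function.Injective (ev x) := fun a b h => Subtype.val_injective (hx h)
  have hne : P.map (ev x) ≠ 0 := (Polynomial.map_ne_zero_iff hinj).2 hP0
  refine (P.map (ev x)).roots.toFinset.finite_toSet.subset ?_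
  rintro r ⟨y, hy, rfl⟩
  -- The coefficients depend only on the values of `s`, so every such `y` yields the same real
  -- polynomial, with `D(y)` as a root.
  have hev : ev x = ev y := by
    ext ⟨a, ha⟩
    change aeval x a = aeval y a
    induction ha using Algebra.adjoin_induction with
    | mem f hf => exact (hy f hf).symm
    | algebraMap r => simp
    | add f g _ _ hf hg => simp [hf, hg]
    | mul f g _ _ hf hg => simp [hf, hg]
  simp only [Finset.mem_coe, Multiset.mem_toFinset, Polynomial.mem_roots hne, Polynomial.IsRoot.def]
  rw [hev, Polynomial.eval_map]
  have := congrArg (aeval y : MvPolynomial ι ℚ →ₐ[ℚ] ℝ) hP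
  rw [Polynomial.aeval_def, map_zero] at this
  rw [← this]
  exact (Polynomial.hom_eval₂ P (algebraMap (Algebra.adjoin ℚ s) (MvPolynomial ι ℚ))
    ((aeval y : MvPolynomial ι ℚ →ₐ[ℚ] ℝ) : MvPolynomial ι ℚ →+* ℝ) D).symm

/-- The differential at `x` of the function defined by a polynomial. -/
noncomputable def differential {ι : Type*} [Fintype ι] (x : ι → ℝ) (f : MvPolynomial ι ℚ) :
    (ι → ℝ) →L[ℝ] ℝ :=
  ∑ i, aeval x (pderiv i f) • ContinuousLinearMap.proj (R := ℝ) (φ := fun _ : ι => ℝ) i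

theorem differential_apply {ι : Type*} [Fintype ι] (x : ι → ℝ) (f : MvPolynomial ι ℚ)
    (w : ι → ℝ) : differential x f w = ∑ i, aeval x (pderiv i f) * w i := by
  simp [differential]

theorem differential_C {ι : Type*} [Fintype ι] (x : ι → ℝ) (a : ℚ) :
    differential x (C a) = 0 := by
  ext; simp [differential_apply]

theorem differential_add {ι : Type*} [Fintype ι] (x : ι → ℝ) (f g : MvPolynomial ι ℚ) :
    differential x (f + g) = differential x f + differential x g := by
  ext; simp [differential_apply, add_mul, Finset.sum_add_distrib]

theorem differential_mul {ι : Type*} [Fintype ι] (x : ι → ℝ) (f g : MvPolynomial ι ℚ) :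
    differential x (f * g) =
      aeval x f • differential x g + aeval x g • differential x f := by
  ext
  simp only [differential_apply, Derivation.leibniz, smul_eq_mul, map_add, map_mul,
    add_apply, smul_apply, Finset.mul_sum,
    ← Finset.sum_add_distrib]
  exact Finset.sum_congr rfl fun i _ => by ring

theorem differential_X {ι : Type*} [Fintype ι] (x : ι → ℝ) (i : ι) :
    differential x (X i) = ContinuousLinearMap.proj (R := ℝ) (φ := fun _ : ι => ℝ) i := by
  classical
  ext w
  simp [differential_apply, pderiv_X, Pi.single_apply, ite_mul]

theorem hasStrictFDerivAt_aeval {ι : Type*} [Fintype ι] (x : ι → ℝ) (f : MvPolynomial ι ℚ) :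
    HasStrictFDerivAt (fun y : ι → ℝ => aeval y f) (differential x f) x := by
  induction f using MvPolynomial.induction_on with
  | C a => simpa [differential_C] using hasStrictFDerivAt_const (algebraMap ℚ ℝ a) x
  | add f g hf hg => simp only [differential_add, map_add]; exact hf.add hg
  | mul_X f i hf =>
    simp only [differential_mul, differential_X, map_mul, aeval_X]
    exact hf.mul (ContinuousLinearMap.proj (R := ℝ) (φ := fun _ : ι => ℝ) i).hasStrictFDerivAt

/-- A tangent vector at a generic point that is annihilated by the differentials of `s` is
annihilated by the differentials of all polynomials algebraic over `s`. -/
theorem differential_eq_zero_of_isAlgebraic {ι : Type*} [Fintype ι] {x : ι → ℝ}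
    (hx : AlgebraicIndependent ℚ x) {s : Set (MvPolynomial ι ℚ)} {w : ι → ℝ}
    (hw : ∀ f ∈ s, differential x f w = 0) {g : MvPolynomial ι ℚ}
    (hg : IsAlgebraic (Algebra.adjoin ℚ s) g) : differential x g w = 0 := by
  classical
  have hadj : ∀ a ∈ Algebra.adjoin ℚ s, differential x a w = 0 := by
    intro a ha
    induction ha using Algebra.adjoin_induction with
    | mem f hf => exact hw f hf
    | algebraMap r => exact congrArg (fun L => L w) (differential_C x r)
    | add f g _ _ hf hg => simp [differential_add, hf, hg]
    | mul f g _ _ hf hg => simp [differential_mul, hf, hg]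
  have hpow : ∀ n : ℕ, differential x (g ^ n) w =
      aeval x ((n : MvPolynomial ι ℚ) * g ^ (n - 1)) * differential x g w := by
    intro n
    induction n with
    | zero => simpa using congrArg (fun L => L w) (differential_C x 1)
    | succ n ih =>
      rw [pow_succ, differential_mul]
      rcases n with _ | n
      · have h1 : differential x 1 w = 0 := by
          simpa using congrArg (fun L => L w) (differential_C x 1)
        simp [h1]
      · simp [ih]; ring
  have hpoly : ∀ P : Polynomial (Algebra.adjoin ℚ s), differential x (Polynomial.aeval g P) w =
      aeval x (Polynomial.aeval g (Polynomial.derivative P)) * differential x g w := by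
    intro P
    induction P using Polynomial.induction_on' with
    | add P Q hP hQ => simp [differential_add, hP, hQ, add_mul]
    | monomial n a =>
      have := hadj a a.2
      simp only [Polynomial.aeval_monomial, Polynomial.derivative_monomial, differential_mul,
        add_apply, smul_apply, hpow, smul_eq_mul]
      change _ + _ * differential x (a : MvPolynomial ι ℚ) w = _
      rw [this]
      simp
      ring
  have hex : ∃ n, ∃ P : Polynomial (Algebra.adjoin ℚ s), P ≠ 0 ∧ Polynomial.aeval g P = 0 ∧
      P.natDegree = n := by
    obtain ⟨P, h0, h1⟩ := hg
    exact ⟨_, P, h0, h1, rfl⟩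
  -- Minimal degree ensures that `P'(g) ≠ 0`; the chain rule `hpoly` then isolates `dg(w)`.
  obtain ⟨P, hP0, hPg, hPn⟩ := Nat.find_spec hex
  have hdeg : P.natDegree ≠ 0 := by
    intro h
    rw [Polynomial.eq_C_of_natDegree_eq_zero h, Polynomial.aeval_C] at hPg
    apply hP0
    rw [Polynomial.eq_C_of_natDegree_eq_zero h]
    have : P.coeff 0 = 0 := Subtype.val_injective hPg
    rw [this, map_zero]
  have hder : Polynomial.aeval g (Polynomial.derivative P) ≠ 0 := by
    intro h
    refine Nat.find_min hex (m := (Polynomial.derivative P).natDegree) ?_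
      ⟨_, ?_, h, rfl⟩
    · rw [← hPn]; exact Polynomial.natDegree_derivative_lt hdeg
    · exact fun h => hdeg (Polynomial.derivative_eq_zero.1 h)
  have h := hpoly P
  rw [hPg] at h
  have h0 : differential x 0 w = 0 := by simpa using congrArg (fun L => L w) (differential_C x 0)
  rw [h0] at h
  rcases mul_eq_zero.1 h.symm with h | h
  · exact absurd (hx (by simpa using h)) hder
  · exact h

/-- If `D` is algebraically independent of `s`, it is not locally constant at a generic point on
the common level set of `s`. -/
theorem frequently_ne_of_algebraicIndepOn_insert {ι : Type*} [Finite ι] {x : ι → ℝ}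
    (hx : AlgebraicIndependent ℚ x) {s : Set (MvPolynomial ι ℚ)} {D : MvPolynomial ι ℚ}
    (hDs : D ∉ s) (hs : AlgebraicIndepOn ℚ id (insert D s)) :
    ∃ᶠ y in 𝓝 x, (∀ f ∈ s, aeval y f = aeval x f) ∧ aeval y D ≠ aeval x D := by
  classical
  have := Fintype.ofFinite ι
  -- A transcendence basis has as many elements as there are variables, so its evaluation map `T`
  -- goes between spaces of equal dimension. Its differential is injective because each `X i` is
  -- algebraic over `B`.
  obtain ⟨B, hsB, hB⟩ := exists_isTranscendenceBasis_superset hs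
  have hcard := (IsTranscendenceBasis.mvPolynomial ι ℚ).lift_cardinalMk_eq hB
  have hfin : Finite B := by
    rw [← Cardinal.mk_lt_aleph0_iff, ← Cardinal.lift_lt_aleph0, ← hcard]
    simp
  have := Fintype.ofFinite B
  have hcard' : Fintype.card ι = Fintype.card B := by
    simpa using hcard
  let T : (ι → ℝ) → (B → ℝ) := fun y b => aeval y (b : MvPolynomial ι ℚ)
  let T' : (ι → ℝ) →L[ℝ] (B → ℝ) := ContinuousLinearMap.pi fun b => differential x b
  have hT : HasStrictFDerivAt T T' x :=
    hasStrictFDerivAt_pi.2 fun b => hasStrictFDerivAt_aeval x b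
  have hinj : Function.Injective T' := by
    rw [injective_iff_map_eq_zero]
    intro w hw
    ext i
    have halg : IsAlgebraic (Algebra.adjoin ℚ B) (X i : MvPolynomial ι ℚ) := by
      have h := hB.isAlgebraic
      rw [Subtype.range_coe] at h
      exact h.isAlgebraic _
    have := differential_eq_zero_of_isAlgebraic hx (w := w)
      (fun f hf => congrFun hw ⟨f, hf⟩) halg
    simpa [differential_X] using this
  have hsurj : T'.range = ⊤ := by
    refine LinearMap.range_eq_top.2 ?_
    exact (LinearMap.injective_iff_surjective_of_finrank_eq_finrank
      (f := (T' : (ι → ℝ) →ₗ[ℝ] (B → ℝ))) (by simp [hcard'])).1 hinj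
  have hmap := hT.map_nhds_eq_of_surj hsurj
  let b₀ : B := ⟨D, hsB (Set.mem_insert _ _)⟩
  rw [Filter.frequently_iff]
  intro U hU
  have hTU : T '' U ∈ 𝓝 (T x) := hmap ▸ Filter.image_mem_map hU
  -- `T` is open at `x`, so the coordinate `D` can be moved alone, all other members of `B` staying
  -- fixed.
  have hcont : Tendsto (fun t : ℝ => Function.update (T x) b₀ (T x b₀ + t)) (𝓝 0) (𝓝 (T x)) := by
    have : Continuous fun t : ℝ => Function.update (T x) b₀ (T x b₀ + t) := by fun_prop
    simpa using this.tendsto 0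
  have hev := (hcont.eventually hTU).filter_mono (nhdsWithin_le_nhds (s := {0}ᶜ))
  obtain ⟨t, ⟨y, hyU, hy⟩, ht⟩ := (hev.and self_mem_nhdsWithin).exists
  refine ⟨y, hyU, fun f hf => ?_, ?_⟩
  · have hne : (⟨f, hsB (Set.mem_insert_of_mem _ hf)⟩ : B) ≠ b₀ := by
      intro h
      exact hDs (by rw [← show f = D from congrArg Subtype.val h]; exact hf)
    have := congrFun hy ⟨f, hsB (Set.mem_insert_of_mem _ hf)⟩
    rwa [Function.update_of_ne hne] at this
  · have := congrFun hy b₀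
    rw [Function.update_self] at this
    intro h
    apply ht
    have h' : T y b₀ = T x b₀ := h
    rw [h'] at this
    simpa using this

theorem exists_pos_eq_of_abs_sub_lt {S : Set ℝ} (hS : S.Finite) (a : ℝ) :
    ∃ δ > 0, ∀ r ∈ S, |r - a| < δ → r = a := by
  have h : (S \ {a})ᶜ ∈ 𝓝 a := (hS.subset Set.sdiff_subset).isClosed.isOpen_compl.mem_nhds (by simp)
  obtain ⟨δ, hδ, hb⟩ := Metric.mem_nhds_iff.1 h
  refine ⟨δ, hδ, fun r hr hra => ?_⟩
  by_contra hne
  exact hb (by simpa [Real.dist_eq] using hra) ⟨hr, hne⟩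

/-- If near a generic point `D` is constant on the common level set of the finite set `F`, then it
takes only finitely many values on the whole level set. -/
theorem finite_values_of_eventually_eq {ι : Type*} [Finite ι] {x : ι → ℝ}
    (hx : AlgebraicIndependent ℚ x) {F : Set (MvPolynomial ι ℚ)} (hF : F.Finite)
    {D : MvPolynomial ι ℚ}
    (hD : ∀ᶠ y in 𝓝 x, (∀ f ∈ F, aeval y f = aeval x f) → aeval y D = aeval x D) :
    {r : ℝ | ∃ y : ι → ℝ, (∀ f ∈ F, aeval y f = aeval x f) ∧ aeval y D = r}.Finite := by
  have := Fintype.ofFinite ι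
  obtain ⟨s, -, hs⟩ := exists_maximal_algebraicIndependent (R := ℚ) (∅ : Set (MvPolynomial ι ℚ)) F
    (Set.empty_subset _) (algebraicIndependent_empty (K := ℚ) (A := MvPolynomial ι ℚ))
  have hsF : s ⊆ F := hs.prop.2
  have hins : ∀ f ∉ s, ¬ IsAlgebraic (Algebra.adjoin ℚ s) f →
      AlgebraicIndepOn ℚ id (insert f s) := by
    intro f hf hfa
    refine (AlgebraicIndepOn.insert_iff hf).2 ⟨hs.prop.1, ?_⟩
    rw [Set.image_id]; exact hfa
  have halgs : ∀ f ∈ s, IsAlgebraic (Algebra.adjoin ℚ s) f := fun f hf =>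
    isAlgebraic_algebraMap (⟨f, Algebra.subset_adjoin hf⟩ : Algebra.adjoin ℚ s)
  have halgF : ∀ f ∈ F, IsAlgebraic (Algebra.adjoin ℚ s) f := by
    intro f hf
    by_contra hfa
    have hfs : f ∉ s := fun h => hfa (halgs f h)
    exact hfs (hs.le_of_ge ⟨hins f hfs hfa, Set.insert_subset hf hsF⟩
      (Set.subset_insert _ _) (Set.mem_insert _ _))
  -- Near `x` the level set of `s` lies in that of `F`: on it each `f ∈ F` takes finitely many
  -- values, and `f` is continuous.
  have hev : ∀ᶠ y in 𝓝 x, (∀ f ∈ s, aeval y f = aeval x f) → ∀ f ∈ F, aeval y f = aeval x f := by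
    have : ∀ f ∈ F, ∀ᶠ y in 𝓝 x, (∀ f ∈ s, aeval y f = aeval x f) → aeval y f = aeval x f := by
      intro f hf
      obtain ⟨δ, hδ, h⟩ :=
        exists_pos_eq_of_abs_sub_lt (finite_values_of_isAlgebraic hx (halgF f hf)) (aeval x f)
      have hc := (hasStrictFDerivAt_aeval x f).continuousAt.eventually (Metric.ball_mem_nhds _ hδ)
      filter_upwards [hc] with y hy hys
      exact h _ ⟨y, hys, rfl⟩ (by simpa [Real.dist_eq] using hy)
    filter_upwards [(Filter.eventually_all_finite hF).2 this] with y hy hys f hf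
    exact hy f hf hys
  have hDalg : IsAlgebraic (Algebra.adjoin ℚ s) D := by
    by_contra hDa
    have hDs : D ∉ s := fun h => hDa (halgs D h)
    obtain ⟨y, ⟨hys, hyD⟩, hy1, hy2⟩ :=
      ((frequently_ne_of_algebraicIndepOn_insert hx hDs (hins D hDs hDa)).and_eventually
        (hev.and hD)).exists
    exact hyD (hy2 (hy1 hys))
  refine (finite_values_of_isAlgebraic hx hDalg).subset ?_
  rintro r ⟨y, hy, rfl⟩
  exact ⟨y, fun f hf => hy f (hsF hf), rfl⟩

/-- A point with algebraically independent coordinates indexed by `S` can be made generic by an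
arbitrarily small change of its other coordinates. -/
theorem exists_algebraicIndependent_near {ι : Type*} [Finite ι] (x : ι → ℝ) (S : Set ι)
    (hS : AlgebraicIndepOn ℚ x S) {ε : ℝ} (hε : 0 < ε) :
    ∃ y : ι → ℝ, AlgebraicIndependent ℚ y ∧ (∀ i ∈ S, y i = x i) ∧ ∀ i, |y i - x i| < ε := by
  classical
  have key : ∀ t : Set ι, t.Finite → ∃ y : ι → ℝ, AlgebraicIndepOn ℚ y (S ∪ t) ∧
      (∀ i ∈ S, y i = x i) ∧ ∀ i, |y i - x i| < ε := by
    intro t ht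
    induction t, ht using Set.Finite.induction_on with
    | empty => exact ⟨x, by simpa using hS, fun _ _ => rfl, fun _ => by simpa using hε⟩
    | @insert a t _ _ ih =>
      obtain ⟨y, hy, hyS, hyε⟩ := ih
      by_cases ha : a ∈ S ∪ t
      · exact ⟨y, by rwa [Set.union_insert, Set.insert_eq_of_mem ha], hyS, hyε⟩
      -- Only countably many reals are algebraic over a countable ring, while an interval is
      -- uncountable.
      · have hcA : Countable (Algebra.adjoin ℚ (y '' (S ∪ t))) := by
          rw [← Cardinal.mk_le_aleph0_iff]
          have hle : Cardinal.mk (y '' (S ∪ t)) ≤ Cardinal.aleph0 :=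
            Cardinal.mk_le_aleph0_iff.2 ((Set.toFinite (S ∪ t)).image y).countable.to_subtype
          exact (Algebra.cardinalMk_adjoin_le ℚ _).trans (by simp [hle])
        have hc : {r : ℝ | IsAlgebraic (Algebra.adjoin ℚ (y '' (S ∪ t))) r}.Countable :=
          Algebraic.countable _ _
        obtain ⟨r, hr, hra⟩ : ∃ r ∈ Set.Ioo (x a - ε) (x a + ε),
            ¬ IsAlgebraic (Algebra.adjoin ℚ (y '' (S ∪ t))) r := by
          by_contra! h
          linarith [Cardinal.Real.Ioo_countable_iff.1 (hc.mono h)]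
        have heq : ∀ i ∈ S ∪ t, Function.update y a r i = y i := fun i hi =>
          Function.update_of_ne (fun h : i = a => ha (h ▸ hi)) _ _
        refine ⟨Function.update y a r, ?_, fun i hi => ?_, fun i => ?_⟩
        · rw [Set.union_insert, AlgebraicIndepOn.insert_iff ha]
          constructor
          swap
          · rw [Set.image_congr heq, Function.update_self]; exact hra
          · have : (fun i : ↥(S ∪ t) => Function.update y a r i) = fun i : ↥(S ∪ t) => y i :=
              funext fun i => heq i i.2
            change AlgebraicIndependent ℚ fun i : ↥(S ∪ t) => Function.update y a r i
            rw [this]; exact hy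
        · rw [heq i (Or.inl hi), hyS i hi]
        · by_cases hi : i = a
          · subst hi
            rw [Function.update_self, abs_lt]
            constructor <;> linarith [hr.1, hr.2]
          · rw [Function.update_of_ne hi]; exact hyε i
  obtain ⟨y, hy, h1, h2⟩ := key Set.univ Set.finite_univ
  rw [Set.union_univ, AlgebraicIndepOn.univ] at hy
  exact ⟨y, hy, h1, h2⟩

end Rigidity

/-! ### Finiteness of distances and generic perturbation of realizations. -/

namespace Rigidity

open MvPolynomial Topology Filter

/-- The realization with given coordinates. -/
def ofCoords {V : Type*} {d : ℕ} (x : V × Fin d → ℝ) : V → EuclideanSpace ℝ (Fin d) :=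
  fun v => WithLp.toLp 2 fun k => x (v, k)

theorem eventually_norm_sub_ofCoords_lt {V : Type*} [Finite V] {d : ℕ}
    (p : V → EuclideanSpace ℝ (Fin d)) {ε : ℝ} (hε : 0 < ε) :
    ∀ᶠ y in 𝓝 (fun i : V × Fin d => p i.1 i.2), ∀ v, ‖p v - ofCoords y v‖ < ε := by
  refine eventually_all.2 fun v => ?_
  have hc : Continuous fun y : V × Fin d → ℝ => ‖p v - ofCoords y v‖ := by
    unfold ofCoords; fun_prop
  refine hc.continuousAt.eventually_lt continuousAt_const ?_
  have : ofCoords (fun i : V × Fin d => p i.1 i.2) v = p v := by ext k; rfl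
  simpa [this] using hε

/-- The squared distance of the vertices `x` and `y` as a polynomial in the coordinates. -/
noncomputable def sqDist {V : Type*} (d : ℕ) (x y : V) : MvPolynomial (V × Fin d) ℚ :=
  ∑ k, (X (x, k) - X (y, k)) ^ 2

theorem aeval_sqDist {V : Type*} {d : ℕ} (x y : V) (q : V → EuclideanSpace ℝ (Fin d)) :
    aeval (fun i : V × Fin d => q i.1 i.2) (sqDist d x y) = ‖q x - q y‖ ^ 2 := by
  simp [sqDist, EuclideanSpace.norm_sq_eq]

theorem aeval_sqDist_ofCoords {V : Type*} {d : ℕ} (x y : V) (c : V × Fin d → ℝ) :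
    aeval c (sqDist d x y) = ‖ofCoords c x - ofCoords c y‖ ^ 2 :=
  aeval_sqDist x y (ofCoords c)

/-- In a rigid graph, the realizations equivalent to a given generic one have only finitely many
distances between two given vertices. -/
theorem RigidGraph.finite_distances {V : Type*} [Finite V] {d : ℕ} {G : SimpleGraph V}
    (hG : RigidGraph d G) {p : V → EuclideanSpace ℝ (Fin d)} (hp : Generic p) (x y : V) :
    {r : ℝ | ∃ q, Equivalent G p q ∧ ‖q x - q y‖ = r}.Finite := by
  let F : Set (MvPolynomial (V × Fin d) ℚ) := {f | ∃ a b, G.Adj a b ∧ sqDist d a b = f}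
  have hF : F.Finite := by
    refine (Set.finite_range fun e : V × V => sqDist d e.1 e.2).subset ?_
    rintro f ⟨a, b, -, rfl⟩
    exact ⟨(a, b), rfl⟩
  obtain ⟨ε, hε, hrig⟩ := hG p hp
  have hD : ∀ᶠ c in 𝓝 (fun i : V × Fin d => p i.1 i.2),
      (∀ f ∈ F, aeval c f = aeval (fun i : V × Fin d => p i.1 i.2) f) →
      aeval c (sqDist d x y) = aeval (fun i : V × Fin d => p i.1 i.2) (sqDist d x y) := by
    filter_upwards [eventually_norm_sub_ofCoords_lt p hε] with c hc hcF
    rw [aeval_sqDist_ofCoords, aeval_sqDist, hrig (ofCoords c) (fun a b hab => ?_) hc x y]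
    have := hcF _ ⟨a, b, hab, rfl⟩
    rw [aeval_sqDist_ofCoords, aeval_sqDist] at this
    exact ((sq_eq_sq₀ (norm_nonneg _) (norm_nonneg _)).1 this).symm
  refine ((finite_values_of_eventually_eq hp hF hD).image Real.sqrt).subset ?_
  rintro r ⟨q, hq, rfl⟩
  refine ⟨‖q x - q y‖ ^ 2, ⟨fun i => q i.1 i.2, ?_, aeval_sqDist x y q⟩,
    Real.sqrt_sq (norm_nonneg _)⟩
  rintro f ⟨a, b, hab, rfl⟩
  rw [aeval_sqDist, aeval_sqDist, hq a b hab]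

/-- A realization whose restriction to `S` is generic can be made generic by an arbitrarily small
move of the other vertices. -/
theorem exists_generic_near {V : Type*} [Finite V] {d : ℕ} (p : V → EuclideanSpace ℝ (Fin d))
    (S : Set V) (hS : Generic fun x : S => p x) {ε : ℝ} (hε : 0 < ε) :
    ∃ q : V → EuclideanSpace ℝ (Fin d), Generic q ∧ (∀ x ∈ S, q x = p x) ∧
      ∀ x, ‖p x - q x‖ < ε := by
  have := Fintype.ofFinite V
  obtain ⟨δ, hδ, hball⟩ := Metric.eventually_nhds_iff.1 (eventually_norm_sub_ofCoords_lt p hε)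
  have hS' : AlgebraicIndepOn ℚ (fun i : V × Fin d => p i.1 i.2) {i | i.1 ∈ S} := by
    let e : {i : V × Fin d | i.1 ∈ S} → S × Fin d := fun i => (⟨i.1.1, i.2⟩, i.1.2)
    have he : Function.Injective e := by
      rintro ⟨⟨a, k⟩, ha⟩ ⟨⟨b, l⟩, hb⟩ h
      simp only [e, Prod.mk.injEq, Subtype.mk.injEq] at h
      exact Subtype.ext (Prod.ext h.1 h.2)
    exact AlgebraicIndependent.comp hS e he
  obtain ⟨y, hy, hyS, hyδ⟩ := exists_algebraicIndependent_near _ _ hS' hδ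
  refine ⟨ofCoords y, hy, fun x hx => ?_, hball ((dist_pi_lt_iff hδ).2 hyδ)⟩
  ext k
  exact hyS (x, k) hx

/-! ### Isometries, and points whose distances force congruence. -/

section Isometry

variable {E : Type*} [NormedAddCommGroup E] [InnerProductSpace ℝ E]

theorem inner_sub_sub_eq_of_congruent {N : Type*} {p q : N → E}
    (h : ∀ x y, ‖p x - p y‖ = ‖q x - q y‖) (x y z : N) :
    inner ℝ (p x - p z) (p y - p z) = inner ℝ (q x - q z) (q y - q z) := by
  have h1 := norm_sub_sq_real (p x - p z) (p y - p z)
  have h2 := norm_sub_sq_real (q x - q z) (q y - q z)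
  rw [sub_sub_sub_cancel_right] at h1 h2
  rw [h x y, h x z, h y z] at h1
  linarith

/-- Gram matrices determine the norms of linear combinations, so `∑ a x • p x ↦ ∑ a x • q x` is well
defined and isometric on the span; finite dimension allows extending it. -/
theorem exists_linearIsometry_of_inner_eq [FiniteDimensional ℝ E] {N : Type*} [Finite N]
    {p q : N → E} (h : ∀ x y, inner ℝ (p x) (p y) = inner ℝ (q x) (q y)) :
    ∃ L : E →ₗᵢ[ℝ] E, ∀ x, L (p x) = q x := by
  classical
  have := Fintype.ofFinite N
  let A := Fintype.linearCombination ℝ p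
  let B := Fintype.linearCombination ℝ q
  have hAB : ∀ a, ‖A a‖ = ‖B a‖ := by
    intro a
    rw [← sq_eq_sq₀ (norm_nonneg _) (norm_nonneg _), ← real_inner_self_eq_norm_sq,
      ← real_inner_self_eq_norm_sq]
    simp only [A, B, Fintype.linearCombination_apply, sum_inner, inner_sum, inner_smul_left,
      inner_smul_right, h]
  have hker : A.ker ≤ B.ker := by
    intro a ha
    rw [LinearMap.mem_ker] at ha ⊢
    rw [← norm_eq_zero, ← hAB, ha, norm_zero]
  let M : A.range →ₗ[ℝ] E := (A.ker.liftQ B hker).comp A.quotKerEquivRange.symm.toLinearMap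
  have hM : ∀ a, M ⟨A a, a, rfl⟩ = B a := by
    intro a
    have : A.quotKerEquivRange.symm ⟨A a, a, rfl⟩ = A.ker.mkQ a := by
      rw [LinearEquiv.symm_apply_eq]; rfl
    simp only [M, LinearMap.comp_apply, LinearEquiv.coe_coe, this]
    rfl
  let L₀ : A.range →ₗᵢ[ℝ] E := ⟨M, by rintro ⟨_, a, rfl⟩; rw [hM, ← hAB]; rfl⟩
  refine ⟨L₀.extend, fun x => ?_⟩
  have hA : A (Pi.single x 1) = p x := by simp [A, Fintype.linearCombination_apply_single]
  have hB : B (Pi.single x 1) = q x := by simp [B, Fintype.linearCombination_apply_single]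
  have := L₀.extend_apply ⟨A (Pi.single x 1), _, rfl⟩
  rw [← hB, ← hM, ← hA]
  exact this

/-- Congruent finite families are related by an isometry of the whole space. -/
theorem exists_isometry_of_congruent [FiniteDimensional ℝ E] {N : Type*} [Finite N]
    {p q : N → E} (h : ∀ x y, ‖p x - p y‖ = ‖q x - q y‖) :
    ∃ Ψ : E → E, (∀ a b, ‖Ψ a - Ψ b‖ = ‖a - b‖) ∧ ∀ x, Ψ (p x) = q x := by
  rcases isEmpty_or_nonempty N with hN | ⟨⟨z⟩⟩
  · exact ⟨id, fun _ _ => rfl, fun x => hN.elim x⟩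
  obtain ⟨L, hL⟩ := exists_linearIsometry_of_inner_eq
    (fun x y => inner_sub_sub_eq_of_congruent h x y z)
  refine ⟨fun a => L (a - p z) + q z, fun a b => ?_, fun x => by simp only [hL]; abel⟩
  rw [add_sub_add_right_eq_sub, ← map_sub, L.norm_map, sub_sub_sub_cancel_right]

theorem exists_pos_mul_lt {b δ : ℝ} (hδ : 0 < δ) : ∃ t > 0, t * b < δ := by
  refine ⟨δ / (|b| + 1), by positivity, ?_⟩
  rw [div_mul_eq_mul_div, div_lt_iff₀ (by positivity)]
  nlinarith [le_abs_self b]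

theorem isOpen_image_add_smul (a : E) {t : ℝ} (ht : t ≠ 0) {U : Set E} (hU : IsOpen U) :
    IsOpen ((fun z => a + t • z) '' U) :=
  ((Homeomorph.smulOfNeZero t ht).trans (Homeomorph.addLeft a)).isOpenMap U hU

/-- There is an open set of vectors `c` such that, for all families `q` in `Q`, the existence of a
vector that is related to `q` as `c` is to `p` forces `q` to have the Gram matrix of `p`. -/
theorem exists_isOpen_inner_rigid {N : Type*} [Finite N] (p : N → E) (Q : Set (N → E))
    (hQ : ∀ q ∈ Q, ∀ x, ‖q x‖ = ‖p x‖) {δ : ℝ} (hδ : 0 < δ)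
    (hQδ : ∀ q ∈ Q, ∀ x y, |inner ℝ (q x) (q y) - inner ℝ (p x) (p y)| < δ →
      inner ℝ (q x) (q y) = inner ℝ (p x) (p y)) (l : List N) :
    ∃ U : Set E, IsOpen U ∧ U.Nonempty ∧ Bornology.IsBounded U ∧ ∀ c ∈ U, ∀ q ∈ Q, ∀ c' : E,
      ‖c'‖ = ‖c‖ → (∀ x, inner ℝ (q x) c' = inner ℝ (p x) c) →
      ∀ y ∈ l, ∀ x, inner ℝ (q x) (q y) = inner ℝ (p x) (p y) := by
  induction l with
  | nil =>
    exact ⟨Metric.ball 0 1, Metric.isOpen_ball, ⟨0, by simp⟩, Metric.isBounded_ball, by simp⟩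
  | cons y l ih =>
    obtain ⟨U, hUo, hUn, hUb, hU⟩ := ih
    obtain ⟨B, hB⟩ := hUb.exists_norm_le
    obtain ⟨m, hm⟩ : ∃ m, ∀ x, ‖p x‖ ≤ m := by
      obtain ⟨m, hm⟩ := (Set.finite_range fun x => ‖p x‖).bddAbove
      exact ⟨m, fun x => hm ⟨x, rfl⟩⟩
    -- With `c = p y + t • z`, `c'` is as close to `q y` as `c` is to `p y`. The Gram entries with
    -- `y` then differ by at most `2 * m * t * B`, hence not at all.
    obtain ⟨t, ht, htδ⟩ := exists_pos_mul_lt (b := 2 * (m * B)) hδ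
    refine ⟨(fun z => p y + t • z) '' U, isOpen_image_add_smul _ ht.ne' hUo, hUn.image _, ?_, ?_⟩
    · refine isBounded_iff_forall_norm_le.2 ⟨‖p y‖ + t * B, ?_⟩
      rintro _ ⟨z, hz, rfl⟩
      refine (norm_add_le _ _).trans ?_
      rw [norm_smul, Real.norm_of_nonneg ht.le]
      gcongr
      exact hB z hz
    · rintro _ ⟨z, hz, rfl⟩ q hq c' hc' hqc
      have hnorm : ‖c' - q y‖ = t * ‖z‖ := by
        rw [← sq_eq_sq₀ (norm_nonneg _) (by positivity), norm_sub_sq_real, hc', hQ q hq y,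
          real_inner_comm, hqc y, norm_add_sq_real, inner_add_right, real_inner_self_eq_norm_sq,
          norm_smul, Real.norm_of_nonneg ht.le]
        ring
      have hy : ∀ x, inner ℝ (q x) (q y) = inner ℝ (p x) (p y) := by
        intro x
        refine hQδ q hq x y (lt_of_le_of_lt ?_ htδ)
        have h1 : inner ℝ (q x) (q y) - inner ℝ (p x) (p y) =
            inner ℝ (p x) (t • z) - inner ℝ (q x) (c' - q y) := by
          rw [inner_sub_right, hqc x, inner_add_right]; ring
        have h2 := abs_real_inner_le_norm (p x) (t • z)
        have h3 := abs_real_inner_le_norm (q x) (c' - q y)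
        rw [hnorm, hQ q hq x] at h3
        rw [norm_smul, Real.norm_of_nonneg ht.le] at h2
        have h4 : ‖p x‖ * (t * ‖z‖) ≤ m * (t * B) := by
          have := (norm_nonneg _).trans (hm x)
          gcongr
          · exact hm x
          · exact hB z hz
        rw [h1]
        refine (abs_sub _ _).trans ?_
        linarith
      -- Subtracting `q y` and rescaling turns `c'` into a partner of `z`, ready for the tail of the
      -- list.
      have hrest := hU z hz q hq (t⁻¹ • (c' - q y)) (by
          rw [norm_smul, hnorm, norm_inv, Real.norm_of_nonneg ht.le]; field_simp) (fun x => by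
          rw [inner_smul_right, inner_sub_right, hqc x, hy x, inner_add_right, inner_smul_right]
          field_simp; ring)
      intro y' hy'
      rcases List.mem_cons.1 hy' with rfl | h
      · exact hy
      · exact hrest y' h

/-- If the families in `Q` have only finitely many distances, there is an open set of points `c`
such that a family in `Q` that can be extended by a point having the same distances as `c` has
from `p` is congruent to `p`. -/
theorem exists_isOpen_congruent {N : Type*} [Finite N] (p : N → E) (Q : Set (N → E))
    (hQ : ∀ x y, {r : ℝ | ∃ q ∈ Q, ‖q x - q y‖ = r}.Finite) :
    ∃ U : Set E, IsOpen U ∧ U.Nonempty ∧ ∀ c ∈ U, ∀ q ∈ Q, ∀ c' : E,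
      (∀ x, ‖p x - c‖ = ‖q x - c'‖) → ∀ x y, ‖p x - p y‖ = ‖q x - q y‖ := by
  rcases isEmpty_or_nonempty N with hN | hN
  · exact ⟨Set.univ, isOpen_univ, Set.univ_nonempty, fun _ _ _ _ _ _ x => hN.elim x⟩
  obtain ⟨z⟩ := id hN
  have hunif : ∀ (D : N → N → Set ℝ) (a : N → N → ℝ), (∀ x y, (D x y).Finite) →
      ∃ δ > 0, ∀ x y, ∀ r ∈ D x y, |r - a x y| < δ → r = a x y := by
    intro D a hD
    choose δ hδ h using fun x y => exists_pos_eq_of_abs_sub_lt (hD x y) (a x y)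
    obtain ⟨e, he⟩ := Finite.exists_min fun e : N × N => δ e.1 e.2
    exact ⟨δ e.1 e.2, hδ _ _, fun x y r hr hlt => h x y r hr (hlt.trans_le (he (x, y)))⟩
  obtain ⟨δ₁, hδ₁, h₁⟩ := hunif _ (fun x y => ‖p x - p y‖) hQ
  obtain ⟨δ₂, hδ₂, h₂⟩ := hunif _ (fun x y => ‖p x - p y‖ ^ 2)
    (fun x y => (hQ x y).image (fun r => r ^ 2))
  have := Fintype.ofFinite N
  have hpol : ∀ q : N → E, (∀ x, ‖q x - q z‖ = ‖p x - p z‖) → ∀ x y,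
      2 * (inner ℝ (q x - q z) (q y - q z) - inner ℝ (p x - p z) (p y - p z)) =
        ‖p x - p y‖ ^ 2 - ‖q x - q y‖ ^ 2 := by
    intro q hq x y
    have e1 := norm_sub_sq_real (p x - p z) (p y - p z)
    have e2 := norm_sub_sq_real (q x - q z) (q y - q z)
    rw [sub_sub_sub_cancel_right] at e1 e2
    rw [hq x, hq y] at e2
    linarith
  -- Vectors are taken from the base point `z`; the factor 2 in `hpol` explains `δ₂ / 2`.
  obtain ⟨U, hUo, hUn, hUb, hU⟩ := exists_isOpen_inner_rigid (fun x => p x - p z)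
    {q | ∃ q' ∈ Q, (∀ x, ‖q' x - q' z‖ = ‖p x - p z‖) ∧ q = fun x => q' x - q' z}
    (by rintro _ ⟨q', _, h, rfl⟩ x; exact h x) (half_pos hδ₂)
    (by
      rintro _ ⟨q', hq', h, rfl⟩ x y hlt
      have e := hpol q' h x y
      have := h₂ x y _ ⟨_, ⟨q', hq', rfl⟩, rfl⟩ (by
        rw [abs_sub_comm, ← e, abs_mul, abs_two]; linarith)
      simp only at this
      linarith) Finset.univ.toList
  obtain ⟨B, hB⟩ := hUb.exists_norm_le
  obtain ⟨t, ht, htδ⟩ := exists_pos_mul_lt (b := 2 * B) hδ₁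
  refine ⟨(fun a => p z + t • a) '' U, isOpen_image_add_smul _ ht.ne' hUo, hUn.image _, ?_⟩
  rintro _ ⟨a, ha, rfl⟩ q hq c' hc
  beta_reduce at hc
  have hcz : ‖c' - q z‖ = t * ‖a‖ := by
    rw [norm_sub_rev, ← hc z, ← sub_sub, sub_self, zero_sub, norm_neg, norm_smul,
      Real.norm_of_nonneg ht.le]
  -- Since `c` is within `t * B` of `p z`, each distance to `z` changes by at most `2 * t * B < δ₁`,
  -- hence by nothing.
  have hz : ∀ x, ‖q x - q z‖ = ‖p x - p z‖ := by
    intro x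
    refine h₁ x z _ ⟨q, hq, rfl⟩ (lt_of_le_of_lt ?_ htδ)
    have e1 := abs_norm_sub_norm_le (q x - q z) (q x - c')
    have e2 := abs_norm_sub_norm_le (p x - (p z + t • a)) (p x - p z)
    rw [sub_sub_sub_cancel_left, hcz] at e1
    rw [sub_sub_sub_cancel_left, hc x, sub_add_cancel_left, norm_neg, norm_smul,
      Real.norm_of_nonneg ht.le] at e2
    have e3 := mul_le_mul_of_nonneg_left (hB a ha) ht.le
    have e4 := abs_sub_le ‖q x - q z‖ ‖q x - c'‖ ‖p x - p z‖
    linarith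
  have hin : ∀ x, inner ℝ (q x - q z) (c' - q z) = t * inner ℝ (p x - p z) a := by
    intro x
    have e1 := norm_sub_sq_real (q x - q z) (c' - q z)
    have e2 := norm_sub_sq_real (p x - p z) (t • a)
    rw [sub_sub_sub_cancel_right, ← hc x, hz x, hcz] at e1
    rw [sub_sub, norm_smul, Real.norm_of_nonneg ht.le, inner_smul_right] at e2
    linarith
  have hgram := hU a ha _ ⟨q, hq, hz, rfl⟩ (t⁻¹ • (c' - q z))
    (by rw [norm_smul, hcz, norm_inv, Real.norm_of_nonneg ht.le]; field_simp)
    (fun x => by rw [inner_smul_right, hin x]; field_simp)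
  intro x y
  have e := hpol q hz x y
  rw [hgram y (by simp) x, sub_self, mul_zero] at e
  exact (sq_eq_sq₀ (norm_nonneg _) (norm_nonneg _)).1 (by linarith)

end Isometry
end Rigidity

/-! ### Contraction of a component, and the two implications. -/

namespace Rigidity

open Topology Filter

section Contraction

variable {V : Type*} {G : SimpleGraph V} {S X : Set V}

theorem toContract_eq_iff {x y : V} :
    toContract S x = toContract S y ↔ x = y ∨ (x ∈ S ∧ y ∈ S) :=
  Quotient.eq (r := contractSetoid S)

theorem toContract_injOn : Set.InjOn (toContract S) Sᶜ := fun _ hx _ _ h =>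
  (toContract_eq_iff.1 h).elim id fun h => absurd h.1 hx

theorem contract_adj_iff {a b : ContractVertex S} : (contract G S).Adj a b ↔
    a ≠ b ∧ ∃ x y, G.Adj x y ∧ toContract S x = a ∧ toContract S y = b :=
  Iff.rfl

theorem contract_adj_toContract {x y : V} (h : G.Adj x y) (hx : x ∉ S) :
    (contract G S).Adj (toContract S x) (toContract S y) :=
  contract_adj_iff.2 ⟨fun he => (toContract_eq_iff.1 he).elim h.ne fun h => hx h.1, x, y, h, rfl,
    rfl⟩

theorem IsComponentOfDelete.nonempty (h : IsComponentOfDelete G X S) : S.Nonempty := by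
  obtain ⟨C, rfl⟩ := h
  exact C.nonempty_supp.image _

theorem IsComponentOfDelete.notMem (h : IsComponentOfDelete G X S) {x : V} (hx : x ∈ S) :
    x ∉ X := by
  obtain ⟨C, rfl⟩ := h
  obtain ⟨a, -, rfl⟩ := hx
  exact a.2

theorem IsComponentOfDelete.mem_of_adj (h : IsComponentOfDelete G X S) {x y : V} (hx : x ∈ S)
    (hy : y ∉ X) (hxy : G.Adj x y) : y ∈ S := by
  obtain ⟨C, rfl⟩ := h
  obtain ⟨a, ha, rfl⟩ := hx
  refine ⟨⟨y, hy⟩, ?_, rfl⟩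
  rw [SimpleGraph.ConnectedComponent.mem_supp_iff] at ha ⊢
  rw [← ha]
  exact SimpleGraph.ConnectedComponent.sound
    (SimpleGraph.Adj.reachable (G := G.induce Xᶜ) (u := ⟨y, hy⟩) (v := a) hxy.symm)

/-- A function that is constant along the edges inside a component is constant on it. -/
theorem IsComponentOfDelete.eq_of_forall_adj (h : IsComponentOfDelete G X S) {α : Type*}
    {f : V → α} (hf : ∀ x ∈ S, ∀ y ∈ S, G.Adj x y → f x = f y) {x y : V} (hx : x ∈ S)
    (hy : y ∈ S) : f x = f y := by
  have h' := h
  obtain ⟨C, rfl⟩ := h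
  obtain ⟨a, ha, rfl⟩ := hx
  obtain ⟨b, hb, rfl⟩ := hy
  rw [SimpleGraph.ConnectedComponent.mem_supp_iff] at hb
  have hab : (G.induce Xᶜ).Reachable a b := by
    rw [SimpleGraph.ConnectedComponent.mem_supp_iff, ← hb] at ha
    exact SimpleGraph.ConnectedComponent.exact ha
  obtain ⟨w⟩ := hab
  induction w with
  | nil => rfl
  | @cons a c b hac _ ih =>
    have hc := h'.mem_of_adj ⟨a, ha, rfl⟩ c.2 hac
    rw [hf _ ⟨a, ha, rfl⟩ _ hc hac]
    obtain ⟨c', hc', hcc⟩ := hc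
    exact ih (Subtype.val_injective hcc ▸ hc') hb

theorem IsComponentOfDelete.reachable (h : IsComponentOfDelete G X S) {x y : V} (hx : x ∈ S)
    (hy : y ∈ S) : G.Reachable x y :=
  SimpleGraph.ConnectedComponent.exact (h.eq_of_forall_adj (f := G.connectedComponentMk)
    (fun _ _ _ _ hab => SimpleGraph.ConnectedComponent.sound hab.reachable) hx hy)

end Contraction

theorem Generic.comp {V W : Type*} {d : ℕ} {p : V → EuclideanSpace ℝ (Fin d)} (hp : Generic p)
    {f : W → V} (hf : Function.Injective f) : Generic fun x => p (f x) :=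
  AlgebraicIndependent.comp hp (fun i : W × Fin d => (f i.1, i.2))
    (hf.prodMap Function.injective_id)

/-- The contracted graph inherits weak global linkedness: the contracted vertex is placed so
that it forces the neighbours of the component into their original relative position. -/
theorem WeaklyGloballyLinked.contract {V : Type*} [Finite V] {d : ℕ} {G : SimpleGraph V} {u v : V}
    {V₀ V₁ : Set V} (hV₀ : PairRigid d G u v V₀) (hV₁ : IsComponentOfDelete G V₀ V₁)
    (h : WeaklyGloballyLinked d G u v) :
    WeaklyGloballyLinked d (contract G V₁) (toContract V₁ u) (toContract V₁ v) := by
  classical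
  obtain ⟨p, hp, hlink⟩ := h
  obtain ⟨hrig, hu, hv⟩ := hV₀
  obtain ⟨w, hw⟩ := hV₁.nonempty
  have hdisj : ∀ {x}, x ∈ V₀ → x ∉ V₁ := fun hx hx' => hV₁.notMem hx' hx
  have hp₀ : Generic fun x : V₀ => p x := hp.comp Subtype.val_injective
  let N := {x : V₀ // ∃ y ∈ V₁, G.Adj x y}
  obtain ⟨U, hUo, ⟨c₀, hc₀⟩, hU⟩ := exists_isOpen_congruent (fun x : N => p x.1)
    {q | ∃ q', Equivalent (G.induce V₀) (fun x : V₀ => p x) q' ∧ q = fun x : N => q' x.1} (by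
      intro x y
      refine (hrig.finite_distances hp₀ x.1 y.1).subset ?_
      rintro r ⟨_, ⟨q', hq', rfl⟩, rfl⟩
      exact ⟨q', hq', rfl⟩)
  obtain ⟨ε, hε, hball⟩ := Metric.isOpen_iff.1 hUo c₀ hc₀
  have hout : ∀ {x}, x ∉ V₁ → (toContract V₁ x).out = x := fun {x} hx =>
    (toContract_eq_iff.1 (Quotient.out_eq (toContract V₁ x))).elim id fun h => absurd h.2 hx
  -- The class of `w` is the contracted vertex; every other class is a singleton, whose `out` is its
  -- only element.
  obtain ⟨P, hPgen, hPeq, hPnear⟩ := exists_generic_near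
    (fun a : ContractVertex V₁ => if a = toContract V₁ w then c₀ else p a.out)
    {toContract V₁ w}ᶜ (by
      have : (fun a : ↥({toContract V₁ w}ᶜ : Set (ContractVertex V₁)) =>
          if a.1 = toContract V₁ w then c₀ else p a.1.out) = fun a => p a.1.out :=
        funext fun a => if_neg a.2
      rw [this]
      exact hp.comp (f := fun a : ↥({toContract V₁ w}ᶜ : Set (ContractVertex V₁)) => a.1.out)
        (Quotient.out_injective.comp Subtype.val_injective)) hε
  have hPp : ∀ {x}, x ∉ V₁ → P (toContract V₁ x) = p x := by
    intro x hx
    have hne : toContract V₁ x ≠ toContract V₁ w := fun he =>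
      (toContract_eq_iff.1 he).elim (fun h => hx (h ▸ hw)) fun h => hx h.1
    rw [hPeq _ hne, if_neg hne, hout hx]
  have hPU : P (toContract V₁ w) ∈ U := by
    refine hball ?_
    have := hPnear (toContract V₁ w)
    rwa [if_pos rfl, norm_sub_rev, ← dist_eq_norm] at this
  refine ⟨P, hPgen, fun q hq => ?_⟩
  have hcong := hU _ hPU (fun x : N => q (toContract V₁ x.1))
    ⟨fun x => q (toContract V₁ x), fun x y hxy => by
      have := hq _ _ (contract_adj_toContract (S := V₁) (G := G) (x := x.1) (y := y.1) hxy
        (hdisj x.2))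
      rwa [hPp (hdisj x.2), hPp (hdisj y.2)] at this, rfl⟩ (q (toContract V₁ w)) (by
      rintro ⟨x, y, hy, hxy⟩
      have := hq _ _ (contract_adj_toContract (S := V₁) hxy (hdisj x.2))
      rwa [hPp (hdisj x.2), toContract_eq_iff.2 (Or.inr ⟨hy, hw⟩)] at this)
  obtain ⟨Ψ, hΨ, hΨN⟩ := exists_isometry_of_congruent hcong
  let Q : V → EuclideanSpace ℝ (Fin d) := fun x => if x ∈ V₁ then Ψ (p x) else q (toContract V₁ x)
  have hmixed : ∀ x y, G.Adj x y → x ∉ V₁ → y ∈ V₁ → ‖p x - p y‖ = ‖Q x - Q y‖ := by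
    intro x y hxy hx hy
    -- Edges leaving the component end in `V₀`, hence in `N`, where `Ψ ∘ p` and `q` agree.
    have hx₀ : x ∈ V₀ := by
      by_contra h
      exact hx (hV₁.mem_of_adj hy h hxy.symm)
    have hQx : Q x = Ψ (p x) := by
      simp only [Q, if_neg hx]
      exact (hΨN ⟨⟨x, hx₀⟩, y, hy, hxy⟩).symm
    rw [hQx]
    simp only [Q, if_pos hy, hΨ]
  have hQ : Equivalent G p Q := by
    intro x y hxy
    by_cases hx : x ∈ V₁ <;> by_cases hy : y ∈ V₁
    · simp only [Q, if_pos hx, if_pos hy, hΨ]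
    · rw [norm_sub_rev, norm_sub_rev (Q x)]
      exact hmixed y x hxy.symm hy hx
    · exact hmixed x y hxy hx hy
    · simp only [Q, if_neg hx, if_neg hy]
      rw [← hq _ _ (contract_adj_toContract hxy hx), hPp hx, hPp hy]
  have := hlink Q hQ
  simp only [Q, if_neg (hdisj hu), if_neg (hdisj hv)] at this
  rw [hPp (hdisj hu), hPp (hdisj hv), this]

/-- Vertices that are globally linked in a contraction lie in the same connected component. -/
theorem GloballyLinked.reachable_of_contract {V : Type*} {d : ℕ} (hd : 1 ≤ d) {G : SimpleGraph V}
    {u v : V} {X S : Set V} (hS : IsComponentOfDelete G X S)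
    {p : ContractVertex S → EuclideanSpace ℝ (Fin d)}
    (h : GloballyLinked (Rigidity.contract G S) p (toContract S u) (toContract S v)) :
    G.Reachable u v := by
  classical
  by_contra huv
  have hreach : ∀ {x y}, toContract S x = toContract S y → G.Reachable x y := fun he =>
    (toContract_eq_iff.1 he).elim (fun h => h ▸ SimpleGraph.Reachable.refl _)
      fun h => hS.reachable h.1 h.2
  let R : ContractVertex S → Prop := fun a => ∃ x, toContract S x = a ∧ G.Reachable u x
  have hR : ∀ x, R (toContract S x) ↔ G.Reachable u x := fun x =>
    ⟨fun ⟨y, hy, huy⟩ => huy.trans (hreach hy), fun h => ⟨x, rfl, h⟩⟩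
  have : Nonempty (Fin d) := ⟨⟨0, hd⟩⟩
  obtain ⟨b, hb⟩ := exists_norm_eq (EuclideanSpace ℝ (Fin d))
    (c := ‖p (toContract S u) - p (toContract S v)‖ + 1) (by positivity)
  -- Translating the component of `u` by `t` keeps all edge lengths and makes the `u`-`v` distance
  -- larger by 1.
  let t := b - (p (toContract S u) - p (toContract S v))
  have := h (fun a => if R a then p a + t else p a) (by
    intro a a' haa
    obtain ⟨-, x, y, hxy, rfl, rfl⟩ := contract_adj_iff.1 haa
    have hiff : G.Reachable u x ↔ G.Reachable u y :=
      ⟨fun h => h.trans hxy.reachable, fun h => h.trans hxy.symm.reachable⟩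
    simp only [hR, hiff]
    split_ifs
    · rw [add_sub_add_right_eq_sub]
    · rfl)
  simp only [hR, huv, SimpleGraph.Reachable.refl, if_true, if_false] at this
  have hb' : p (toContract S u) + t - p (toContract S v) = b := by simp only [t]; abel
  rw [hb', hb] at this
  linarith

/-- The edges of a fixed walk have length at most `K` in every `q n`, so `M` can be chosen
independently of `n`. -/
theorem exists_bound_of_reachable {V : Type*} {d : ℕ} {G : SimpleGraph V}
    (p q : ℕ → V → EuclideanSpace ℝ (Fin d)) (hpq : ∀ n, Equivalent G (p n) (q n)) (K : ℝ)
    (hp : ∀ n x y, ‖p n x - p n y‖ ≤ K) {u x : V} (h : G.Reachable u x) :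
    ∃ M, ∀ n, ‖q n x - q n u‖ ≤ M := by
  obtain ⟨w⟩ := h
  induction w with
  | nil => exact ⟨0, by simp⟩
  | @cons u a x hua _ ih =>
    obtain ⟨M, hM⟩ := ih
    refine ⟨M + K, fun n => (norm_sub_le_norm_sub_add_norm_sub _ (q n a) _).trans ?_⟩
    have := hp n a u
    rw [hpq n a u hua.symm] at this
    linarith [hM n]

/-- Weak global linkedness lifts from the contraction: generic realizations close to the one that
collapses the component are globally linked. -/
theorem WeaklyGloballyLinked.of_contract {V : Type*} [Finite V] {d : ℕ} (hd : 1 ≤ d)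
    {G : SimpleGraph V} {u v : V} {V₀ V₁ : Set V} (hV₀ : PairRigid d G u v V₀)
    (hV₁ : IsComponentOfDelete G V₀ V₁)
    (h : WeaklyGloballyLinked d (Rigidity.contract G V₁) (toContract V₁ u) (toContract V₁ v)) :
    WeaklyGloballyLinked d G u v := by
  classical
  have := Fintype.ofFinite V
  obtain ⟨p, hp, hlink⟩ := h
  obtain ⟨hrig, hu, hv⟩ := hV₀
  have hdisj : ∀ {x}, x ∈ V₀ → x ∉ V₁ := fun hx hx' => hV₁.notMem hx' hx
  have huv := hlink.reachable_of_contract hd hV₁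
  let p' : V → EuclideanSpace ℝ (Fin d) := fun x => p (toContract V₁ x)
  have hinj : Function.Injective fun x : ↥(V₁ᶜ) => toContract V₁ x.1 :=
    Set.injOn_iff_injective.1 toContract_injOn
  choose P hPgen hPeq hPnear using fun n : ℕ =>
    exists_generic_near p' V₁ᶜ (hp.comp hinj) (Nat.one_div_pos_of_nat (α := ℝ) (n := n))
  by_contra hcon
  have hex : ∀ n, ∃ q, Equivalent G (P n) q ∧ ‖P n u - P n v‖ ≠ ‖q u - q v‖ := by
    intro n
    by_contra! hn
    exact hcon ⟨P n, hPgen n, hn⟩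
  choose q hq hqne using hex
  have hPlim : ∀ x, Tendsto (fun n => P n x) atTop (𝓝 (p' x)) := fun x => by
    rw [tendsto_iff_norm_sub_tendsto_zero]
    refine squeeze_zero (fun _ => norm_nonneg _) (fun n => ?_) tendsto_one_div_add_atTop_nhds_zero_nat
    rw [norm_sub_rev]
    exact (hPnear n x).le
  obtain ⟨K₀, hK₀⟩ := (Set.finite_range fun e : V × V => ‖p' e.1 - p' e.2‖).bddAbove
  have hP1 : ∀ n x, ‖p' x - P n x‖ ≤ 1 := fun n x => (hPnear n x).le.trans (by
    rw [div_le_one (by positivity)]; linarith [Nat.cast_nonneg (α := ℝ) n])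
  have hK : ∀ n x y, ‖P n x - P n y‖ ≤ K₀ + 2 := by
    intro n x y
    have e1 : ‖p' x - p' y‖ ≤ K₀ := hK₀ ⟨(x, y), rfl⟩
    have e2 := norm_sub_le_norm_sub_add_norm_sub (P n x) (p' x) (P n y)
    have e3 := norm_sub_le_norm_sub_add_norm_sub (p' x) (p' y) (P n y)
    have e4 := hP1 n x
    have e5 := hP1 n y
    rw [norm_sub_rev] at e4
    linarith
  -- For compactness, `u` is moved to the origin and the components not containing `u` are reset to
  -- `P n`.
  let Q : ℕ → V → EuclideanSpace ℝ (Fin d) := fun n x =>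
    if G.Reachable u x then q n x - q n u else P n x
  have hQ : ∀ n, Equivalent G (P n) (Q n) := by
    intro n x y hxy
    have hiff : G.Reachable u x ↔ G.Reachable u y :=
      ⟨fun h => h.trans hxy.reachable, fun h => h.trans hxy.symm.reachable⟩
    simp only [Q, hiff]
    split_ifs
    · rw [sub_sub_sub_cancel_right]; exact hq n x y hxy
    · rfl
  have hQuv : ∀ n, Q n u - Q n v = q n u - q n v := by
    intro n
    simp only [Q, huv, SimpleGraph.Reachable.refl, if_true, sub_sub_sub_cancel_right]
  have hbound : ∀ x, ∃ M, ∀ n, ‖Q n x‖ ≤ M := by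
    intro x
    by_cases hx : G.Reachable u x
    · simp only [Q, if_pos hx]
      exact exists_bound_of_reachable P q hq _ hK hx
    · simp only [Q, if_neg hx]
      refine ⟨‖p' x‖ + 1, fun n => ?_⟩
      have e := hP1 n x
      rw [norm_sub_rev] at e
      linarith [norm_le_norm_add_norm_sub' (P n x) (p' x)]
  choose M hM using hbound
  obtain ⟨q', -, φ, hφ, hlim⟩ := tendsto_subseq_of_bounded (x := Q)
    (s := Set.univ.pi fun x => Metric.closedBall 0 (M x))
    (Bornology.IsBounded.pi fun x => Metric.isBounded_closedBall)
    (fun n x _ => by simpa using hM x n)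
  have hlim' : ∀ x, Tendsto (fun n => Q (φ n) x) atTop (𝓝 (q' x)) := tendsto_pi_nhds.1 hlim
  have hq' : Equivalent G p' q' := by
    intro x y hxy
    refine tendsto_nhds_unique
      (((hPlim x).comp hφ.tendsto_atTop).sub ((hPlim y).comp hφ.tendsto_atTop)).norm
      (Tendsto.congr (fun n => ?_) ((hlim' x).sub (hlim' y)).norm)
    exact (hQ (φ n) x y hxy).symm
  -- `p'` collapses `V₁`, so edges inside `V₁` have length zero in `q'` too.
  have hconst : ∀ x ∈ V₁, ∀ y ∈ V₁, q' x = q' y := fun x hx y hy =>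
    hV₁.eq_of_forall_adj (fun a ha b hb hab => by
      have := hq' a b hab
      simp only [p', toContract_eq_iff.2 (Or.inr ⟨ha, hb⟩), sub_self, norm_zero] at this
      exact sub_eq_zero.1 (norm_eq_zero.1 this.symm)) hx hy
  let q₁ : ContractVertex V₁ → EuclideanSpace ℝ (Fin d) := Quotient.lift q' (by
    rintro x y (rfl | ⟨hx, hy⟩)
    · rfl
    · exact hconst x hx y hy)
  have hdist : ‖p' u - p' v‖ = ‖q' u - q' v‖ := hlink q₁ (by
    intro a b hab
    obtain ⟨-, x, y, hxy, rfl, rfl⟩ := contract_adj_iff.1 hab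
    exact hq' x y hxy)
  have hPV₀ : ∀ n, ∀ x ∈ V₀, P n x = p' x := fun n x hx => hPeq n x (hdisj hx)
  have hgen₀ : Generic fun x : V₀ => p' x :=
    hp.comp (f := fun x : V₀ => toContract V₁ x.1) fun x y hxy =>
      Subtype.ext (toContract_injOn (hdisj x.2) (hdisj y.2) hxy)
  -- All `P n` agree with `p'` on `V₀`, so one finite set of distances serves every `n`.
  obtain ⟨δ, hδ, hfin⟩ := exists_pos_eq_of_abs_sub_lt
    (hrig.finite_distances hgen₀ ⟨u, hu⟩ ⟨v, hv⟩) ‖p' u - p' v‖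
  have hconv : Tendsto (fun n => ‖Q (φ n) u - Q (φ n) v‖) atTop (𝓝 ‖p' u - p' v‖) := by
    rw [hdist]
    exact ((hlim' u).sub (hlim' v)).norm
  obtain ⟨n, hn⟩ := (hconv.eventually (Metric.ball_mem_nhds _ hδ)).exists
  have heq := hfin _ ⟨fun x => Q (φ n) x, fun x y hxy => by
    have := hQ (φ n) x y hxy
    rwa [hPV₀ _ _ x.2, hPV₀ _ _ y.2] at this, rfl⟩ hn
  apply hqne (φ n)
  rw [hPV₀ _ _ hu, hPV₀ _ _ hv, ← hQuv]
  exact heq.symm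

end Rigidity

theorem mainTheorem6 {V : Type*} [Finite V] (d : ℕ) (hd : 1 ≤ d) (G : SimpleGraph V) (u v : V)
    (V₀ V₁ : Set V) (hV₀ : Rigidity.PairRigid d G u v V₀)
    (hV₁ : Rigidity.IsComponentOfDelete G V₀ V₁) :
    Rigidity.WeaklyGloballyLinked d G u v ↔
      Rigidity.WeaklyGloballyLinked d (Rigidity.contract G V₁)
        (Rigidity.toContract V₁ u) (Rigidity.toContract V₁ v) :=
  ⟨Rigidity.WeaklyGloballyLinked.contract hV₀ hV₁,
    Rigidity.WeaklyGloballyLinked.of_contract hd hV₀ hV₁⟩
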